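/- For each integer $M\ge 0$ there exists a finite constant $C=C(M)$ such that the following holds. Let $G=(V,E)$ be a connected (simple) graph with all degrees at most $M$, and suppose that $G$ is amenable, meaning that $\inf_W |\partial W|/\sum_{w\in W}\deg(w)=0$, where the infimum is over nonempty finite sets $W\subseteq V$ and $\partial W$ denotes the set of edges with exactly one endpoint in $W$. Let $P^n(x,y)$ be the $n$-step transition probabilities of the lazy simple random walk $(X_m)_{m\ge 0}$ on $G$ (which stays still with probability $1/2$ at each step and otherwise moves to a uniformly random neighbour), let $d_G$ be the graph distance, and put \[ \mathrm{TV}_n=\sup_{x\sim y}\tfrac12\sum_{z\in V}|P^n(x,z)-P^n(y,z)|,\qquad D^*_n=\sup_{x\in V}\max_{0\le m\le n}\mathbf{E}_x[d_G(X_0,X_m)], \] \[ H^*_n=\sup_{x\in V}\max_{0\le m\le n}\sum_{y\in V}P^m(x,y)\bigl(-\log P^m(x,y)\bigr), \] where $0\log 0=0$ and $x\sim y$ means that $x$ and $y$ are adjacent. Then for every $n\ge 1$ there exists a nonempty finite set $W_n\subseteq V$ such that \[ \operatorname{diam}(W_n)\le \min\Bigl\{2n,\;C\,D^*_n\log\frac1{\mathrm{TV}_n}\Bigr\},\qquad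 \log|W_n|\le\min\Bigl\{2Mn,\;C\,(H^*_n+\log n)\log\frac1{\mathrm{TV}_n}\Bigr\}, \] and \[ \frac{|\partial W_n|}{\sum_{w\in W_n}\deg(w)}\le 4\,\mathrm{TV}_n . \] Here the diameter is taken in the metric $d_G$. If $\mathrm{TV}_n=0$, then $\log(1/\mathrm{TV}_n)=+\infty$ and the two minima are read as $2n$ and $2Mn$. For the one-vertex graph, the walk stays put, $\mathrm{TV}_n=0$, and the ratio $0/0$ is read as $0$. -/

import Mathlib

/-! Lazy random walk, total variation profile, displacement, entropy and edge boundary of a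
locally finite graph. -/

namespace LazyWalk

variable {V : Type*} (G : SimpleGraph V) [G.LocallyFinite]

open Classical in
/-- One-step transition probabilities of the simple random walk: jump to a uniformly chosen
neighbour. (The walk stays put at an isolated vertex; in a connected graph this only concerns
the graph with a single vertex.) -/
noncomputable def simpleStep (x y : V) : ℝ :=
  if G.degree x = 0 then (if x = y then 1 else 0)
  else if G.Adj x y then 1 / (G.degree x : ℝ) else 0

open Classical in
/-- One-step transition probabilities of the lazy simple random walk: stay still with
probability `1/2`, otherwise take a step of the simple random walk. -/
noncomputable def lazyStep (x y : V) : ℝ :=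
  1 / 2 * (if x = y then 1 else 0) + 1 / 2 * simpleStep G x y

open Classical in
/-- The `n`-step transition probabilities `P^n(x, y)` of the lazy simple random walk.
The sum over intermediate vertices has finite support, by local finiteness. -/
noncomputable def P : ℕ → V → V → ℝ
  | 0, x, y => if x = y then 1 else 0
  | n + 1, x, y => ∑' z, lazyStep G x z * P n z y

/-- Total variation distance between the laws of the lazy walks started at `x` and `y`
at time `n` (a finitely supported sum). -/
noncomputable def tvDist (n : ℕ) (x y : V) : ℝ :=
  1 / 2 * ∑' z, |P G n x z - P G n y z|

/-- The total variation profile: the supremum of `tvDist` over pairs of neighbours.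
All the terms lie in `[0, 1]`; the supremum is `0` if there are no edges. -/
noncomputable def TV (n : ℕ) : ℝ :=
  ⨆ p : {p : V × V // G.Adj p.1 p.2}, tvDist G n p.1.1 p.1.2

/-- Expected graph distance from the starting point `x` at time `m`. -/
noncomputable def expDisplacement (m : ℕ) (x : V) : ℝ :=
  ∑' y, P G m x y * (G.dist x y : ℝ)

/-- Entropy of the law of the walk started at `x` at time `m`, with `0 log 0 = 0`. -/
noncomputable def entropy (m : ℕ) (x : V) : ℝ :=
  ∑' y, P G m x y * (-Real.log (P G m x y))

/-- `D*_n`, the supremal expected displacement up to time `n`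
(the supremum is over a family with values in `[0, n]`). -/
noncomputable def Dstar (n : ℕ) : ℝ :=
  ⨆ x : V, (Finset.range (n + 1)).sup' Finset.nonempty_range_add_one
    fun m => expDisplacement G m x

/-- `H*_n`, the supremal entropy up to time `n`. If degrees are at most `M`, the supremum is over
a family with values in `[0, n log (M + 1)]`, the law at time `m` being carried by at most
`(M + 1) ^ m` points. -/
noncomputable def Hstar (n : ℕ) : ℝ :=
  ⨆ x : V, (Finset.range (n + 1)).sup' Finset.nonempty_range_add_one
    fun m => entropy G m x

/-- The edges with one endpoint in `W` and the other not in `W`. -/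
def edgeBoundary {V : Type*} (G : SimpleGraph V) (W : Finset V) : Set (Sym2 V) :=
  {e | ∃ x ∈ W, ∃ y, y ∉ W ∧ G.Adj x y ∧ e = s(x, y)}

/-- The boundary-to-volume ratio `|∂W| / ∑_{w ∈ W} deg w`. The boundary of a finite set is
finite, by local finiteness. -/
noncomputable def boundaryRatio (W : Finset V) : ℝ :=
  ((edgeBoundary G W).ncard : ℝ) / ∑ w ∈ W, (G.degree w : ℝ)

/-- A graph is amenable if the infimum of the boundary-to-volume ratio over its nonempty
finite sets of vertices is zero. -/
def IsAmenable : Prop :=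
  ⨅ W : {W : Finset V // W.Nonempty}, boundaryRatio G W.1 = 0

/-- The diameter, in the graph distance, of a finite set of vertices. -/
noncomputable def setDiam {V : Type*} (G : SimpleGraph V) (W : Finset V) : ℕ :=
  W.sup fun x => W.sup fun y => G.dist x y

end LazyWalk

/-! Write `τ` for `TV_n` and regard `P^n(x, z)` as a function of `x`. Summed over `z`, its positive
differences across an edge total at most `τ`, while its mass at each `x` is `1`. Averaging over `z`
and over a Følner set `A` therefore yields a `z` for which the edge variation is of order `τ` times
the degree-weighted mass. By the coarea formula (`exists_superlevel_boundaryRatio_le`) some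
superlevel set has boundary ratio of order `τ`.

To keep superlevel sets small, `truncP` first restricts to `d(x, z) ≤ r` and lowers the function by
`exp (-s)`. Leaving a ball of radius about `5 D*_n` has probability at most `1/4`, and successive
exits multiply, so `r` of order `D*_n log (1/τ)` makes the first loss at most `τ/4`
(`expect_indicator_ball_compl_le`). The second costs mass at most `(1 + H*_n) / (1 + s)`, so `s` of
order `1 + H*_n` suffices (`sub_mul_le_max_sub_exp`). A vertex of the superlevel set is then within
`r` of `z` and satisfies `P^n(x, z) > exp (-s)`; by reversibility there are at most `M exp s` of
these (`card_mul_exp_le`).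

This is run for `0 < τ < 1/4`. If `τ ≥ 1/4` a single vertex works; if `τ = 0` the graph is finite
and all of `V` works. -/

namespace LazyWalk

variable {V : Type*} (G : SimpleGraph V) [G.LocallyFinite]

/-! ### Transition probabilities -/

open Classical in
/-- A vertex together with its neighbours. -/
noncomputable def closedNbhd (x : V) : Finset V := insert x (G.neighborFinset x)

open Classical in
/-- The vertices that the lazy walk can reach from `x` in exactly `n` steps. -/
noncomputable def reach : ℕ → V → Finset V
  | 0, x => {x}
  | n + 1, x => (closedNbhd G x).biUnion (reach n)

/-- The expectation of `f (X_n)` for the lazy walk started at `x`. -/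
noncomputable def expect (n : ℕ) (f : V → ℝ) (x : V) : ℝ := ∑' y, P G n x y * f y

lemma mem_closedNbhd {x y : V} : y ∈ closedNbhd G x ↔ y = x ∨ G.Adj x y := by
  simp [closedNbhd]

lemma mem_closedNbhd_comm {x y : V} : y ∈ closedNbhd G x ↔ x ∈ closedNbhd G y := by
  simp [mem_closedNbhd, G.adj_comm, eq_comm]

lemma self_mem_closedNbhd (x : V) : x ∈ closedNbhd G x := by simp [mem_closedNbhd]

lemma card_closedNbhd_le {M : ℕ} (hM : ∀ v, G.degree v ≤ M) (x : V) :
    (closedNbhd G x).card ≤ M + 1 := by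
  classical
  exact (Finset.card_insert_le _ _).trans (by simpa using hM x)

lemma card_reach_le {M : ℕ} (hM : ∀ v, G.degree v ≤ M) (n : ℕ) (x : V) :
    (reach G n x).card ≤ (M + 1) ^ n := by
  induction n generalizing x with
  | zero => simp [reach]
  | succ n ih =>
    classical
    rw [reach, pow_succ']
    exact (Finset.card_biUnion_le_card_mul _ _ _ fun z _ => ih z).trans
      (Nat.mul_le_mul_right _ (card_closedNbhd_le G hM x))

lemma dist_le_of_mem_reach (hG : G.Connected) {n : ℕ} {x y : V} (h : y ∈ reach G n x) :
    G.dist x y ≤ n := by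
  induction n generalizing x with
  | zero => simp_all [reach]
  | succ n ih =>
    simp only [reach, Finset.mem_biUnion] at h
    obtain ⟨z, hz, hy⟩ := h
    have h1 : G.dist x z ≤ 1 := by
      rcases (mem_closedNbhd G).1 hz with rfl | h
      · simp
      · exact (SimpleGraph.dist_eq_one_iff_adj.2 h).le
    have := hG.dist_triangle (u := x) (v := z) (w := y)
    have := ih hy
    omega

lemma simpleStep_nonneg (x y : V) : 0 ≤ simpleStep G x y := by
  unfold simpleStep; split_ifs <;> positivity

lemma lazyStep_nonneg (x y : V) : 0 ≤ lazyStep G x y := by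
  have := simpleStep_nonneg G x y
  unfold lazyStep; split_ifs <;> linarith

lemma lazyStep_eq_zero {x y : V} (h : y ∉ closedNbhd G x) : lazyStep G x y = 0 := by
  rw [mem_closedNbhd, not_or] at h
  simp [lazyStep, simpleStep, Ne.symm h.1, h.2]

lemma lazyStep_self_pos (x : V) : 0 < lazyStep G x x := by
  have := simpleStep_nonneg G x x
  simp only [lazyStep, if_true]; linarith

lemma sum_simpleStep (x : V) : ∑ z ∈ closedNbhd G x, simpleStep G x z = 1 := by
  classical
  by_cases h : G.degree x = 0
  · simp [simpleStep, h, self_mem_closedNbhd]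
  · rw [closedNbhd, Finset.sum_insert (by simp)]
    have h1 : ∀ z ∈ G.neighborFinset x, simpleStep G x z = 1 / (G.degree x : ℝ) := by
      intro z hz
      simp [simpleStep, h, (G.mem_neighborFinset x z).1 hz]
    rw [Finset.sum_congr rfl h1]
    have : (G.degree x : ℝ) ≠ 0 := by exact_mod_cast h
    simp [simpleStep, h]

lemma sum_lazyStep (x : V) : ∑ z ∈ closedNbhd G x, lazyStep G x z = 1 := by
  classical
  simp only [lazyStep, Finset.sum_add_distrib, ← Finset.mul_sum, sum_simpleStep]
  simp [self_mem_closedNbhd]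
  norm_num

lemma degree_mul_lazyStep (x y : V) :
    G.degree x * lazyStep G x y = G.degree y * lazyStep G y x := by
  rcases eq_or_ne x y with rfl | hxy
  · rfl
  by_cases h : G.Adj x y
  · have hx : G.degree x ≠ 0 := (G.degree_pos_iff_exists_adj x).2 ⟨y, h⟩ |>.ne'
    have hy : G.degree y ≠ 0 := (G.degree_pos_iff_exists_adj y).2 ⟨x, h.symm⟩ |>.ne'
    have hx' : (G.degree x : ℝ) ≠ 0 := by exact_mod_cast hx
    have hy' : (G.degree y : ℝ) ≠ 0 := by exact_mod_cast hy
    simp [lazyStep, simpleStep, hx, hy, hxy, hxy.symm, h, h.symm]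
    field_simp
  · rw [lazyStep_eq_zero, lazyStep_eq_zero] <;> simp [mem_closedNbhd, hxy, hxy.symm, h, G.adj_comm y x]

lemma P_succ (n : ℕ) (x y : V) :
    P G (n + 1) x y = ∑ z ∈ closedNbhd G x, lazyStep G x z * P G n z y :=
  tsum_eq_sum fun z hz => by rw [lazyStep_eq_zero G hz, zero_mul]

lemma P_nonneg (n : ℕ) (x y : V) : 0 ≤ P G n x y := by
  induction n generalizing x with
  | zero => unfold P; split_ifs <;> simp
  | succ n ih =>
    rw [P_succ]
    exact Finset.sum_nonneg fun z _ => mul_nonneg (lazyStep_nonneg G x z) (ih z)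

lemma P_one (x y : V) : P G 1 x y = lazyStep G x y := by
  classical
  rw [P_succ]
  by_cases h : y ∈ closedNbhd G x
  · simp [P, h]
  · simp [P, h, lazyStep_eq_zero G h]

lemma P_succ_right (n : ℕ) (x y : V) :
    P G (n + 1) x y = ∑ z ∈ closedNbhd G y, P G n x z * lazyStep G z y := by
  classical
  induction n generalizing x with
  | zero =>
    rw [zero_add, P_one]
    by_cases h : x ∈ closedNbhd G y
    · simp [P, h]
    · simp [P, h, lazyStep_eq_zero G (mt (mem_closedNbhd_comm G).1 h)]
  | succ n ih =>
    rw [P_succ]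
    simp only [ih, Finset.mul_sum]
    rw [Finset.sum_comm]
    refine Finset.sum_congr rfl fun z _ => ?_
    rw [P_succ, Finset.sum_mul]
    exact Finset.sum_congr rfl fun w _ => by ring

/-- Reversibility: it allows sums over starting points to be bounded by sums over endpoints. -/
lemma degree_mul_P (n : ℕ) (x y : V) :
    G.degree x * P G n x y = G.degree y * P G n y x := by
  induction n generalizing x with
  | zero =>
    rcases eq_or_ne x y with rfl | h
    · rfl
    · simp [P, h, h.symm]
  | succ n ih =>
    rw [P_succ, P_succ_right, Finset.mul_sum, Finset.mul_sum]
    refine Finset.sum_congr rfl fun z _ => ?_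
    rw [← mul_assoc, degree_mul_lazyStep, mul_right_comm, ih]
    ring

lemma P_eq_zero {n : ℕ} {x y : V} (h : y ∉ reach G n x) : P G n x y = 0 := by
  classical
  induction n generalizing x with
  | zero => simp [reach] at h; simp [P, Ne.symm h]
  | succ n ih =>
    rw [P_succ]
    refine Finset.sum_eq_zero fun z hz => ?_
    rw [ih fun hy => h (Finset.mem_biUnion.2 ⟨z, hz, hy⟩), mul_zero]

lemma P_self_pos (n : ℕ) (x : V) : 0 < P G n x x := by
  induction n with
  | zero => simp [P]
  | succ n ih =>
    rw [P_succ]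
    exact Finset.sum_pos' (fun z _ => mul_nonneg (lazyStep_nonneg G x z) (P_nonneg G n z x))
      ⟨x, self_mem_closedNbhd G x, mul_pos (lazyStep_self_pos G x) ih⟩

lemma expect_eq_sum (n : ℕ) (f : V → ℝ) (x : V) :
    expect G n f x = ∑ y ∈ reach G n x, P G n x y * f y :=
  tsum_eq_sum fun y hy => by rw [P_eq_zero G hy, zero_mul]

lemma expect_zero (f : V → ℝ) (x : V) : expect G 0 f x = f x := by
  simp [expect_eq_sum, reach, P]

lemma summable_P_mul (n : ℕ) (f : V → ℝ) (x : V) : Summable fun y => P G n x y * f y :=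
  summable_of_ne_finset_zero (s := reach G n x) fun y hy => by rw [P_eq_zero G hy, zero_mul]

lemma summable_P (n : ℕ) (x : V) : Summable (P G n x) := by
  simpa using summable_P_mul G n 1 x

lemma expect_succ (n : ℕ) (f : V → ℝ) (x : V) :
    expect G (n + 1) f x = ∑ z ∈ closedNbhd G x, lazyStep G x z * expect G n f z := by
  simp only [expect, P_succ, Finset.sum_mul, mul_assoc]
  rw [Summable.tsum_finsetSum fun z _ => (summable_P_mul G n f z).mul_left _]
  exact Finset.sum_congr rfl fun z _ => tsum_mul_left

lemma expect_one (n : ℕ) (x : V) : expect G n (fun _ => 1) x = 1 := by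
  induction n generalizing x with
  | zero => exact expect_zero G _ x
  | succ n ih => simp [expect_succ, ih, sum_lazyStep]

lemma tsum_P (n : ℕ) (x : V) : ∑' y, P G n x y = 1 := by
  simpa [expect] using expect_one G n x

lemma sum_P_of_reach_subset {n : ℕ} {x : V} {S : Finset V} (h : reach G n x ⊆ S) :
    ∑ y ∈ S, P G n x y = 1 := by
  rw [← tsum_P G n x]
  exact (tsum_eq_sum fun y hy => P_eq_zero G fun h' => hy (h h')).symm

lemma sum_P_le_one (n : ℕ) (x : V) (S : Finset V) : ∑ y ∈ S, P G n x y ≤ 1 := by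
  rw [← tsum_P G n x]
  exact (summable_P G n x).sum_le_tsum _ fun y _ => P_nonneg G n x y

lemma P_le_one (n : ℕ) (x y : V) : P G n x y ≤ 1 := by
  simpa using sum_P_le_one G n x {y}

lemma expect_mono {n : ℕ} {f g : V → ℝ} {x : V} (h : ∀ y ∈ reach G n x, f y ≤ g y) :
    expect G n f x ≤ expect G n g x := by
  rw [expect_eq_sum, expect_eq_sum]
  exact Finset.sum_le_sum fun y hy => mul_le_mul_of_nonneg_left (h y hy) (P_nonneg G n x y)

lemma expect_const (n : ℕ) (c : ℝ) (x : V) : expect G n (fun _ => c) x = c := by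
  simp [expect, tsum_mul_right, tsum_P]

lemma expect_sub (n : ℕ) (f g : V → ℝ) (x : V) :
    expect G n (fun y => f y - g y) x = expect G n f x - expect G n g x := by
  simp only [expect, mul_sub]
  exact (summable_P_mul G n f x).tsum_sub (summable_P_mul G n g x)

/-! ### Exit probabilities -/

open Classical in
/-- The probability that the lazy walk started at `x` leaves `B` by time `m`. -/
noncomputable def exitProb (B : Set V) : ℕ → V → ℝ
  | 0, x => if x ∈ B then 0 else 1
  | m + 1, x => if x ∈ B then ∑ z ∈ closedNbhd G x, lazyStep G x z * exitProb B m z else 1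

/-- The closed ball for the graph distance. -/
def ball {V : Type*} (G : SimpleGraph V) (x : V) (r : ℕ) : Set V := {y | G.dist x y ≤ r}

lemma mem_ball {V : Type*} {G : SimpleGraph V} {x y : V} {r : ℕ} : y ∈ ball G x r ↔ G.dist x y ≤ r := Iff.rfl

lemma exitProb_of_notMem {B : Set V} {x : V} (h : x ∉ B) (m : ℕ) : exitProb G B m x = 1 := by
  cases m <;> simp [exitProb, h]

lemma exitProb_zero_of_mem {B : Set V} {x : V} (h : x ∈ B) : exitProb G B 0 x = 0 := by
  simp [exitProb, h]

lemma exitProb_succ_of_mem {B : Set V} {x : V} (h : x ∈ B) (m : ℕ) :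
    exitProb G B (m + 1) x = ∑ z ∈ closedNbhd G x, lazyStep G x z * exitProb G B m z := by
  simp [exitProb, h]

lemma exitProb_nonneg (B : Set V) (m : ℕ) (x : V) : 0 ≤ exitProb G B m x := by
  induction m generalizing x with
  | zero => unfold exitProb; split_ifs <;> simp
  | succ m ih =>
    unfold exitProb
    split_ifs
    · exact Finset.sum_nonneg fun z _ => mul_nonneg (lazyStep_nonneg G x z) (ih z)
    · simp

lemma sum_lazyStep_mul_le {f g : V → ℝ} {x : V} (h : ∀ z ∈ closedNbhd G x, f z ≤ g z) :
    ∑ z ∈ closedNbhd G x, lazyStep G x z * f z ≤ ∑ z ∈ closedNbhd G x, lazyStep G x z * g z :=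
  Finset.sum_le_sum fun z hz => mul_le_mul_of_nonneg_left (h z hz) (lazyStep_nonneg G x z)

lemma exitProb_le_one (B : Set V) (m : ℕ) (x : V) : exitProb G B m x ≤ 1 := by
  induction m generalizing x with
  | zero => unfold exitProb; split_ifs <;> simp
  | succ m ih =>
    by_cases hx : x ∈ B
    · rw [exitProb_succ_of_mem G hx]
      refine (sum_lazyStep_mul_le G fun z _ => ih z).trans ?_
      simp [sum_lazyStep]
    · exact (exitProb_of_notMem G hx _).le

lemma exitProb_anti {B B' : Set V} (h : B ⊆ B') (m : ℕ) (x : V) :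
    exitProb G B' m x ≤ exitProb G B m x := by
  induction m generalizing x with
  | zero =>
    by_cases hx : x ∈ B
    · rw [exitProb_zero_of_mem G hx, exitProb_zero_of_mem G (h hx)]
    · rw [exitProb_of_notMem G hx]
      exact exitProb_le_one G _ _ _
  | succ m ih =>
    by_cases hx : x ∈ B
    · rw [exitProb_succ_of_mem G hx, exitProb_succ_of_mem G (h hx)]
      exact sum_lazyStep_mul_le G fun z _ => ih z
    · rw [exitProb_of_notMem G hx]
      exact exitProb_le_one G _ _ _

open Classical in
lemma expect_indicator_compl_le_exitProb (B : Set V) (m : ℕ) (x : V) :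
    expect G m (fun y => if y ∈ B then 0 else 1) x ≤ exitProb G B m x := by
  induction m generalizing x with
  | zero => rw [expect_zero, exitProb]
  | succ m ih =>
    by_cases hx : x ∈ B
    · rw [expect_succ, exitProb_succ_of_mem G hx]
      exact sum_lazyStep_mul_le G fun z _ => ih z
    · rw [exitProb_of_notMem G hx]
      exact (expect_mono G (g := fun _ => 1) fun y _ => by split_ifs <;> norm_num).trans
        (expect_one G _ x).le

/-- If the expected displacement is at most `D` up to time `n`, a walk that leaves the ball of
radius `R` about `x₀` ends at expected distance at least `R + 1 - D` from `x₀`. -/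
lemma exitProb_ball_mul_le (hG : G.Connected) {n : ℕ} {D : ℝ}
    (hD : ∀ m ≤ n, ∀ x, expDisplacement G m x ≤ D) (x₀ : V) (R m : ℕ) (hm : m ≤ n) (x : V) :
    exitProb G (ball G x₀ R) m x * (R + 1 - D) ≤ expect G m (fun y => (G.dist x₀ y : ℝ)) x := by
  have key : ∀ m ≤ n, ∀ x ∉ ball G x₀ R,
      (R + 1 - D : ℝ) ≤ expect G m (fun y => (G.dist x₀ y : ℝ)) x := by
    intro m hm x hx
    have h1 : expect G m (fun y => (G.dist x₀ x : ℝ) - G.dist x y) x ≤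
        expect G m (fun y => (G.dist x₀ y : ℝ)) x := by
      refine expect_mono G fun y _ => ?_
      have := hG.dist_triangle (u := x₀) (v := y) (w := x)
      rw [G.dist_comm (u := y)] at this
      have : (G.dist x₀ x : ℝ) ≤ G.dist x₀ y + G.dist x y := by exact_mod_cast this
      linarith
    rw [expect_sub, expect_const] at h1
    have h2 : expect G m (fun y => (G.dist x y : ℝ)) x ≤ D := hD m hm x
    have h3 : (R + 1 : ℝ) ≤ G.dist x₀ x := by
      rw [mem_ball, not_le] at hx
      exact_mod_cast hx
    linarith
  induction m generalizing x with
  | zero =>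
    by_cases hx : x ∈ ball G x₀ R
    · rw [exitProb_zero_of_mem G hx, expect_zero]
      simp
    · rw [exitProb_of_notMem G hx, one_mul]
      exact key 0 hm x hx
  | succ m ih =>
    by_cases hx : x ∈ ball G x₀ R
    -- Inside the ball both sides are averages over the first step, so the bound at exit points
    -- propagates inward.
    · rw [exitProb_succ_of_mem G hx, expect_succ, Finset.sum_mul]
      simp only [mul_assoc]
      exact sum_lazyStep_mul_le G fun z _ => ih (by omega) z
    · rw [exitProb_of_notMem G hx, one_mul]
      exact key _ hm x hx

/-- To leave the ball of radius `R + R' + 1` about `x₀`, the walk first has to leave the ball of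
radius `R`, and then a ball of radius `R'` about the exit point. -/
lemma exitProb_ball_add_le (hG : G.Connected) {n : ℕ} {a : ℝ} {R' : ℕ}
    (ha : ∀ m ≤ n, ∀ x, exitProb G (ball G x R') m x ≤ a) (x₀ : V) (R m : ℕ) (hm : m ≤ n)
    (x : V) (hx : G.dist x₀ x ≤ R + 1) :
    exitProb G (ball G x₀ (R + R' + 1)) m x ≤ a * exitProb G (ball G x₀ R) m x := by
  have key : ∀ m ≤ n, ∀ x, G.dist x₀ x ≤ R + 1 → x ∉ ball G x₀ R →
      exitProb G (ball G x₀ (R + R' + 1)) m x ≤ a * exitProb G (ball G x₀ R) m x := by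
    intro m hm x hx hx'
    rw [exitProb_of_notMem G hx', mul_one]
    -- The exit point overshoots by at most one step, so the `R'`-ball about it lies in the ball of
    -- radius `R + R' + 1`.
    refine (exitProb_anti G (fun y hy => ?_) m x).trans (ha m hm x)
    have := hG.dist_triangle (u := x₀) (v := x) (w := y)
    rw [mem_ball] at hy ⊢
    omega
  induction m generalizing x with
  | zero =>
    by_cases hx' : x ∈ ball G x₀ R
    · rw [exitProb_zero_of_mem G hx', exitProb_zero_of_mem, mul_zero]
      rw [mem_ball] at hx' ⊢
      omega
    · exact key 0 hm x hx hx'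
  | succ m ih =>
    by_cases hx' : x ∈ ball G x₀ R
    · rw [exitProb_succ_of_mem G hx', exitProb_succ_of_mem, Finset.mul_sum]
      · simp only [mul_left_comm a]
        refine sum_lazyStep_mul_le G fun z hz => ih (by omega) z ?_
        rw [mem_ball] at hx'
        rcases (mem_closedNbhd G).1 hz with rfl | h
        · omega
        · have := hG.dist_triangle (u := x₀) (v := x) (w := z)
          rw [SimpleGraph.dist_eq_one_iff_adj.2 h] at this
          omega
      · rw [mem_ball] at hx' ⊢
        omega
    · exact key _ hm x hx hx'

lemma exitProb_ball_mul_succ_le (hG : G.Connected) {n : ℕ} {a : ℝ} {R : ℕ}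
    (ha : ∀ m ≤ n, ∀ x, exitProb G (ball G x R) m x ≤ a) (k m : ℕ) (hm : m ≤ n) (x : V) :
    exitProb G (ball G x (k * (R + 1))) m x ≤ a ^ k := by
  induction k generalizing m x with
  | zero => simpa using exitProb_le_one G _ m x
  | succ k ih =>
    have ha0 : 0 ≤ a := (exitProb_nonneg G _ m x).trans (ha m hm x)
    have h := exitProb_ball_add_le G hG (fun m hm x => ih m hm x) x R m hm x (by simp)
    rw [show (k + 1) * (R + 1) = R + k * (R + 1) + 1 by ring, pow_succ]
    exact h.trans (mul_le_mul_of_nonneg_left (ha m hm x) (pow_nonneg ha0 k))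

-- A single exit has probability at most `D / (R + 1 - D) ≤ 1/4`, and reaching the large radius
-- requires `k` of them.
open Classical in
lemma expect_indicator_ball_compl_le (hG : G.Connected) {n : ℕ} {D : ℝ}
    (hD : ∀ m ≤ n, ∀ x, expDisplacement G m x ≤ D) {R : ℕ} (hR : 5 * D ≤ R) (k : ℕ) (x : V) :
    expect G n (fun y => if y ∈ ball G x (k * (R + 1)) then 0 else 1) x ≤ (1 / 4) ^ k := by
  refine (expect_indicator_compl_le_exitProb G (ball G x (k * (R + 1))) n x).trans
    (exitProb_ball_mul_succ_le G hG (fun m hm x => ?_) k n le_rfl x)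
  have h1 := (exitProb_ball_mul_le G hG hD x R m hm x).trans (hD m hm x)
  have h2 := exitProb_nonneg G (ball G x R) m x
  nlinarith

/-! ### Uniform bounds on the walk -/

lemma tvDist_eq_sum {n : ℕ} {x y : V} {Z : Finset V} (hx : reach G n x ⊆ Z)
    (hy : reach G n y ⊆ Z) : tvDist G n x y = 1 / 2 * ∑ z ∈ Z, |P G n x z - P G n y z| := by
  rw [tvDist, tsum_eq_sum fun z hz => ?_]
  rw [P_eq_zero G fun h => hz (hx h), P_eq_zero G fun h => hz (hy h)]
  simp

/-- Both laws have mass one, so the signed differences cancel. -/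
lemma sum_posPart_eq_tvDist {n : ℕ} {x y : V} {Z : Finset V} (hx : reach G n x ⊆ Z)
    (hy : reach G n y ⊆ Z) : ∑ z ∈ Z, max (P G n x z - P G n y z) 0 = tvDist G n x y := by
  have h : ∀ z, max (P G n x z - P G n y z) 0 =
      1 / 2 * |P G n x z - P G n y z| + 1 / 2 * (P G n x z - P G n y z) := by
    intro z
    rcases le_total 0 (P G n x z - P G n y z) with h | h
    · rw [max_eq_left h, abs_of_nonneg h]; ring
    · rw [max_eq_right h, abs_of_nonpos h]; ring
  simp only [h, Finset.sum_add_distrib, ← Finset.mul_sum, Finset.sum_sub_distrib,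
    sum_P_of_reach_subset G hx, sum_P_of_reach_subset G hy, tvDist_eq_sum G hx hy]
  ring

lemma tvDist_nonneg (n : ℕ) (x y : V) : 0 ≤ tvDist G n x y :=
  mul_nonneg (by norm_num) (tsum_nonneg fun _ => abs_nonneg _)

lemma tvDist_le_one (n : ℕ) (x y : V) : tvDist G n x y ≤ 1 := by
  classical
  rw [← sum_posPart_eq_tvDist G (Finset.subset_union_left (s₂ := reach G n y))
    Finset.subset_union_right]
  refine (Finset.sum_le_sum fun z _ => ?_).trans (sum_P_le_one G n x _)
  exact max_le (sub_le_self _ (P_nonneg G n y z)) (P_nonneg G n x z)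

lemma TV_nonneg (n : ℕ) : 0 ≤ TV G n := Real.iSup_nonneg fun _ => tvDist_nonneg G _ _ _

lemma TV_le_one (n : ℕ) : TV G n ≤ 1 :=
  Real.iSup_le (fun _ => tvDist_le_one G _ _ _) zero_le_one

lemma tvDist_le_TV (n : ℕ) {x y : V} (h : G.Adj x y) : tvDist G n x y ≤ TV G n :=
  le_ciSup (f := fun p : {p : V × V // G.Adj p.1 p.2} => tvDist G n p.1.1 p.1.2)
    ⟨1, Set.forall_mem_range.2 fun _ => tvDist_le_one G _ _ _⟩ ⟨(x, y), h⟩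

/-- A real supremum of an unbounded family is `0` by convention, so some bound `B` is required; its
size is irrelevant. -/
lemma le_iSup_sup'_range {f : ℕ → V → ℝ} {n : ℕ} {B : ℝ} (hf : ∀ m ≤ n, ∀ x, f m x ≤ B)
    {m : ℕ} (hm : m ≤ n) (x : V) :
    f m x ≤ ⨆ x : V, (Finset.range (n + 1)).sup' Finset.nonempty_range_add_one fun m => f m x := by
  refine le_trans ?_ (le_ciSup ⟨B, Set.forall_mem_range.2 fun x => ?_⟩ x)
  · exact Finset.le_sup' (fun m => f m x) (Finset.mem_range.2 (by omega))
  · exact Finset.sup'_le _ _ fun m hm => hf m (by simpa [Nat.lt_succ_iff] using hm) x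

lemma expDisplacement_le (hG : G.Connected) (m : ℕ) (x : V) : expDisplacement G m x ≤ m := by
  refine (expect_mono G (g := fun _ => (m : ℝ)) fun y hy => ?_).trans (expect_const G m m x).le
  exact_mod_cast dist_le_of_mem_reach G hG hy

lemma expDisplacement_le_Dstar (hG : G.Connected) {m n : ℕ} (hm : m ≤ n) (x : V) :
    expDisplacement G m x ≤ Dstar G n :=
  le_iSup_sup'_range (B := n)
    (fun m hm x => (expDisplacement_le G hG m x).trans (by exact_mod_cast hm)) hm x

lemma entropy_eq_sum {n : ℕ} {x : V} {Z : Finset V} (hx : reach G n x ⊆ Z) :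
    entropy G n x = ∑ y ∈ Z, P G n x y * (-Real.log (P G n x y)) :=
  tsum_eq_sum fun y hy => by rw [P_eq_zero G fun h => hy (hx h), zero_mul]

lemma mul_neg_log_le_one {p : ℝ} (hp : 0 ≤ p) : p * (-Real.log p) ≤ 1 := by
  rcases hp.eq_or_lt with rfl | hp
  · simp
  · have h := Real.one_sub_inv_le_log_of_pos hp
    have h2 : p * p⁻¹ = 1 := mul_inv_cancel₀ hp.ne'
    nlinarith

lemma entropy_le {M : ℕ} (hM : ∀ v, G.degree v ≤ M) (m : ℕ) (x : V) :
    entropy G m x ≤ ((M + 1) ^ m : ℕ) := by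
  rw [entropy_eq_sum G subset_rfl]
  refine (Finset.sum_le_sum fun y _ => mul_neg_log_le_one (P_nonneg G m x y)).trans ?_
  simpa using (Nat.cast_le (α := ℝ)).2 (card_reach_le G hM m x)

lemma entropy_le_Hstar {M : ℕ} (hM : ∀ v, G.degree v ≤ M) {m n : ℕ} (hm : m ≤ n) (x : V) :
    entropy G m x ≤ Hstar G n :=
  le_iSup_sup'_range (B := ((M + 1) ^ n : ℕ))
    (fun m hm x => (entropy_le G hM m x).trans
      (by exact_mod_cast Nat.pow_le_pow_right M.succ_pos hm)) hm x

lemma lazyStep_le_half {x : V} (hx : 0 < G.degree x) (y : V) : lazyStep G x y ≤ 1 / 2 := by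
  have h1 : (1 / (G.degree x : ℝ)) ≤ 1 := by
    rw [div_le_one (by exact_mod_cast hx)]
    exact_mod_cast hx
  rcases eq_or_ne x y with rfl | h
  · simp [lazyStep, simpleStep, hx.ne']
  · simp only [lazyStep, simpleStep, hx.ne', h, if_false]
    split_ifs <;> linarith

/-- The walk leaves a non-isolated vertex with probability `1/2`. The bound serves to absorb
additive constants into multiples of `D*_n`; `half_le_entropy_one` does the same for `H*_n`. -/
lemma half_le_expDisplacement_one (hG : G.Connected) {x : V} (hx : 0 < G.degree x) :
    1 / 2 ≤ expDisplacement G 1 x := by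
  classical
  have h1 : expect G 1 (fun y => 1 - if y = x then 1 else 0) x ≤ expDisplacement G 1 x := by
    refine expect_mono G fun y _ => ?_
    rcases eq_or_ne y x with rfl | h
    · simp
    · simpa [h, Nat.one_le_iff_ne_zero] using (hG.pos_dist_of_ne h.symm).ne'
  rw [expect_sub, expect_one] at h1
  have h2 : expect G 1 (fun y => if y = x then 1 else 0) x = lazyStep G x x := by
    simp [expect, P_one]
  have := lazyStep_le_half G hx x
  linarith

lemma half_le_entropy_one {x : V} (hx : 0 < G.degree x) : 1 / 2 ≤ entropy G 1 x := by
  have hsum : ∑ y ∈ reach G 1 x, 1 / 2 * P G 1 x y = 1 / 2 := by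
    rw [← Finset.mul_sum, sum_P_of_reach_subset G subset_rfl, mul_one]
  rw [entropy_eq_sum G subset_rfl, ← hsum]
  refine Finset.sum_le_sum fun y _ => ?_
  have h0 := P_nonneg G 1 x y
  have h1 : P G 1 x y ≤ 1 / 2 := by rw [P_one]; exact lazyStep_le_half G hx y
  rcases h0.eq_or_lt with h | h
  · simp [← h]
  · have h2 := Real.log_le_log h h1
    have h3 := Real.log_two_gt_d9
    rw [one_div, Real.log_inv] at h2
    nlinarith

/-! ### Superlevel sets -/

open Classical in
lemma ncard_edgeBoundary (W : Finset V) :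
    ((edgeBoundary G W).ncard : ℝ) =
      ∑ x ∈ W, ∑ y ∈ G.neighborFinset x, if y ∈ W then (0 : ℝ) else 1 := by
  have h : edgeBoundary G W =
      ((W.sigma fun x => (G.neighborFinset x).filter (· ∉ W)).image
        fun p : (_ : V) × V => s(p.1, p.2) : Finset (Sym2 V)) := by
    ext e
    simp only [edgeBoundary, Set.mem_ofPred_eq, Finset.coe_image, Set.mem_image, Finset.mem_coe,
      Finset.mem_sigma, Finset.mem_filter, SimpleGraph.mem_neighborFinset, Sigma.exists]
    constructor
    · rintro ⟨x, hx, y, hy, hxy, rfl⟩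
      exact ⟨x, y, ⟨hx, hxy, hy⟩, rfl⟩
    · rintro ⟨x, y, ⟨hx, hxy, hy⟩, rfl⟩
      exact ⟨x, hx, y, hy, hxy, rfl⟩
  rw [h, Set.ncard_coe_finset, Finset.card_image_of_injOn, Finset.card_sigma]
  · push_cast
    refine Finset.sum_congr rfl fun x _ => ?_
    rw [Finset.card_filter]
    push_cast
    exact Finset.sum_congr rfl fun y _ => by split_ifs <;> simp_all
  -- A boundary edge has only one orientation pointing out of `W`.
  · rintro ⟨x, y⟩ hp ⟨x', y'⟩ hp' h
    simp only [Finset.coe_sigma, Set.mem_sigma_iff, Finset.mem_coe, Finset.mem_filter] at hp hp'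
    rcases Sym2.eq_iff.1 h with ⟨rfl, rfl⟩ | ⟨rfl, rfl⟩
    · rfl
    · exact absurd hp.1 hp'.2.2

open MeasureTheory in
lemma integrable_indicator_Ico (a b : ℝ) :
    Integrable ((Set.Ico a b).indicator fun _ => (1 : ℝ)) :=
  (integrable_indicator_iff measurableSet_Ico).2 (integrableOn_const (by simp))

open MeasureTheory in
lemma integral_indicator_Ico (a b : ℝ) :
    ∫ t, (Set.Ico a b).indicator (fun _ => (1 : ℝ)) t = max (b - a) 0 := by
  rw [integral_indicator_const _ measurableSet_Ico, Real.volume_real_Ico]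
  simp

open Classical MeasureTheory in
/-- If the total variation of a function `f ≥ 0` carried by the finite set `A` is less than
`c` times its mass, then some superlevel set of `f` has boundary-to-volume ratio at most `c`. -/
lemma exists_superlevel_boundaryRatio_le {A : Finset V} {f : V → ℝ} {c : ℝ} (hc : 0 ≤ c)
    (hf : ∀ x, 0 ≤ f x) (hfA : ∀ x ∉ A, f x = 0)
    (h : ∑ x ∈ A, ∑ y ∈ G.neighborFinset x, max (f x - f y) 0 <
      c * ∑ x ∈ A, G.degree x * f x) :
    ∃ t, 0 ≤ t ∧ (A.filter (t < f ·)).Nonempty ∧ boundaryRatio G (A.filter (t < f ·)) ≤ c := by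
  by_contra! hcon
  refine h.not_ge ?_
  -- Coarea: at level `t`, the two sides are `c` times the volume and the boundary size of the
  -- superlevel set; integrating over `t` contradicts `h`.
  have h1 : ∀ t, c * ∑ x ∈ A, G.degree x * (Set.Ico 0 (f x)).indicator (fun _ => (1 : ℝ)) t ≤
      ∑ x ∈ A, ∑ y ∈ G.neighborFinset x, (Set.Ico (f y) (f x)).indicator (fun _ => (1 : ℝ)) t := by
    intro t
    have hR : 0 ≤ ∑ x ∈ A, ∑ y ∈ G.neighborFinset x,
        (Set.Ico (f y) (f x)).indicator (fun _ => (1 : ℝ)) t :=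
      Finset.sum_nonneg fun x _ => Finset.sum_nonneg fun y _ =>
        Set.indicator_nonneg (fun _ _ => zero_le_one) t
    rcases lt_or_ge t 0 with ht | ht
    · refine le_trans (le_of_eq ?_) hR
      simp [Set.indicator, ht.not_ge]
    set W := A.filter (t < f ·) with hW
    have hvol : ∑ x ∈ A, G.degree x * (Set.Ico 0 (f x)).indicator (fun _ => (1 : ℝ)) t =
        ∑ x ∈ W, (G.degree x : ℝ) := by
      rw [hW, Finset.sum_filter]
      refine Finset.sum_congr rfl fun x _ => ?_
      by_cases hx : t < f x <;> simp [Set.indicator, ht, hx]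
    have hbd : ∑ x ∈ A, ∑ y ∈ G.neighborFinset x,
        (Set.Ico (f y) (f x)).indicator (fun _ => (1 : ℝ)) t = (edgeBoundary G W).ncard := by
      rw [ncard_edgeBoundary]
      conv_rhs => rw [hW, Finset.sum_filter]
      refine Finset.sum_congr rfl fun x _ => ?_
      by_cases hx : t < f x
      · rw [if_pos hx]
        refine Finset.sum_congr rfl fun y _ => ?_
        -- Since `f` vanishes off `A` and `t ≥ 0`, membership in `A` is automatic.
        have hy : y ∈ A.filter (t < f ·) ↔ t < f y := by
          rw [Finset.mem_filter, and_iff_right_iff_imp]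
          intro hy
          by_contra hyA
          rw [hfA y hyA] at hy
          exact hy.not_ge ht
        by_cases hy' : t < f y
        · rw [if_pos (hy.2 hy')]
          simp [Set.indicator, hy']
        · rw [if_neg (mt hy.1 hy')]
          simp [Set.indicator, hx, not_lt.1 hy']
      · simp [Set.indicator, hx]
    rw [hvol, hbd]
    rcases W.eq_empty_or_nonempty with hE | hne
    · simp [hE]
    have hlt := hcon t ht hne
    rw [boundaryRatio] at hlt
    -- Zero volume would give ratio `0` by the division convention, contradicting `c < 0 / 0`.
    have hpos : 0 < ∑ x ∈ W, (G.degree x : ℝ) := by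
      refine lt_of_le_of_ne (Finset.sum_nonneg fun _ _ => Nat.cast_nonneg _) fun h0 => ?_
      rw [← hW, ← h0, div_zero] at hlt
      exact hlt.not_ge hc
    exact ((lt_div_iff₀ hpos).1 hlt).le
  have h2 := integral_mono (μ := volume)
    ((integrable_finsetSum A fun x _ =>
      (integrable_indicator_Ico 0 (f x)).const_mul (G.degree x : ℝ)).const_mul c)
    (integrable_finsetSum A fun x _ => integrable_finsetSum (G.neighborFinset x) fun y _ =>
      integrable_indicator_Ico (f y) (f x)) h1
  rw [integral_const_mul, integral_finsetSum _ fun x _ =>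
      (integrable_indicator_Ico 0 (f x)).const_mul (G.degree x : ℝ),
    integral_finsetSum _ fun x _ => integrable_finsetSum (G.neighborFinset x) fun y _ =>
      integrable_indicator_Ico (f y) (f x)] at h2
  simp only [integral_const_mul, integral_finsetSum _ fun y _ =>
      integrable_indicator_Ico (f y) _, integral_indicator_Ico, sub_zero,
      max_eq_left (hf _)] at h2
  exact h2

/-! ### Truncated transition probabilities -/

/-- With `u = -log p`, this says `min p (exp (-s)) ≤ p (1 + u) / (1 + s)`. For `u ≤ s` it follows
from `exp (s - u) ≥ 1 + s - u` and `(1 + u)(1 + s - u) ≥ 1 + s`. Summed over endpoints, it is a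
Markov-type bound by entropy on the mass lost to the threshold. -/
lemma sub_mul_le_max_sub_exp {p s : ℝ} (hp0 : 0 ≤ p) (hp1 : p ≤ 1) (hs : 0 ≤ s) :
    p - (p + p * (-Real.log p)) / (1 + s) ≤ max (p - Real.exp (-s)) 0 := by
  rcases hp0.eq_or_lt with rfl | hp
  · simp
  set u := -Real.log p with hu
  have hu0 : 0 ≤ u := neg_nonneg.2 (Real.log_nonpos hp0 hp1)
  rcases le_total s u with h | h
  · refine le_max_of_le_right (sub_nonpos.2 ?_)
    rw [le_div_iff₀ (by linarith)]
    nlinarith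
  · refine le_max_of_le_left (sub_le_sub_left ?_ p)
    have hpu : p = Real.exp (-u) := by rw [hu, neg_neg, Real.exp_log hp]
    have h1 : Real.exp (-s) = p * Real.exp (-(s - u)) := by
      rw [hpu, ← Real.exp_add]
      congr 1
      ring
    have h2 : Real.exp (-(s - u)) ≤ (1 + u) / (1 + s) := by
      have h3 := Real.add_one_le_exp (s - u)
      rw [Real.exp_neg, inv_le_iff_one_le_mul₀ (Real.exp_pos _),
        div_mul_eq_mul_div, one_le_div₀ (by linarith)]
      nlinarith
    rw [h1, ← mul_one_add, mul_div_assoc]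
    exact mul_le_mul_of_nonneg_left h2 hp0

open Classical in
/-- The transition probability `P^n(x, z)`, lowered by `θ` and restricted to `x ∈ A` within
distance `r` of `z`. -/
noncomputable def truncP (A : Finset V) (n r : ℕ) (θ : ℝ) (z x : V) : ℝ :=
  if x ∈ A ∧ z ∈ ball G x r then max (P G n x z - θ) 0 else 0

lemma truncP_nonneg (A : Finset V) (n r : ℕ) (θ : ℝ) (z x : V) : 0 ≤ truncP G A n r θ z x := by
  unfold truncP; split_ifs <;> simp

lemma truncP_le (A : Finset V) (n r : ℕ) {θ : ℝ} (hθ : 0 ≤ θ) (z x : V) :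
    truncP G A n r θ z x ≤ P G n x z := by
  have := P_nonneg G n x z
  unfold truncP
  split_ifs
  · exact max_le (by linarith) this
  · exact this

lemma of_truncP_pos {A : Finset V} {n r : ℕ} {θ : ℝ} {z x : V} (h : 0 < truncP G A n r θ z x) :
    G.dist x z ≤ r ∧ θ < P G n x z := by
  unfold truncP at h
  split_ifs at h with hx
  · refine ⟨hx.2, ?_⟩
    rcases lt_max_iff.1 h with h | h
    · linarith
    · exact absurd h (lt_irrefl 0)
  · exact absurd h (lt_irrefl 0)

-- Lowering by `θ` and taking positive parts is 1-Lipschitz. The cutoff adds a loss only where `z`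
-- is far from `y`, an event of probability at most `q` from `y`.
open Classical in
lemma sum_posPart_truncP_le {A Z : Finset V} {n r : ℕ} {θ q : ℝ} {x y : V} (hθ : 0 ≤ θ)
    (hy : y ∈ A) (hq : expect G n (fun z => if z ∈ ball G y r then 0 else 1) y ≤ q)
    (hxZ : reach G n x ⊆ Z) (hyZ : reach G n y ⊆ Z) :
    ∑ z ∈ Z, max (truncP G A n r θ z x - truncP G A n r θ z y) 0 ≤ tvDist G n x y + q := by
  have hq' : ∑ z ∈ Z, P G n y z * (if z ∈ ball G y r then 0 else 1) ≤ q := by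
    refine le_trans (le_of_eq ?_) hq
    exact (tsum_eq_sum fun z hz => by rw [P_eq_zero G fun h => hz (hyZ h), zero_mul]).symm
  rw [← sum_posPart_eq_tvDist G hxZ hyZ]
  refine le_trans ?_ (add_le_add_right hq' _)
  rw [← Finset.sum_add_distrib]
  refine Finset.sum_le_sum fun z _ => ?_
  have h0 := P_nonneg G n y z
  have h1 := truncP_le G A n r hθ z x
  have h2 := truncP_nonneg G A n r θ z y
  have h3 := le_max_left (P G n x z - P G n y z) 0
  have h4 := le_max_right (P G n x z - P G n y z) 0
  by_cases hz : z ∈ ball G y r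
  · have h5 : truncP G A n r θ z y = max (P G n y z - θ) 0 := if_pos ⟨hy, hz⟩
    have h6 : truncP G A n r θ z x ≤ max (P G n x z - θ) 0 := by
      unfold truncP; split_ifs <;> simp
    rw [if_pos hz, mul_zero, add_zero, h5]
    refine max_le ?_ h4
    rcases le_total (P G n x z - θ) 0 with h | h
    · rw [max_eq_right h] at h6
      linarith [le_max_right (P G n y z - θ) 0]
    · rw [max_eq_left h] at h6
      linarith [le_max_left (P G n y z - θ) 0]
  · rw [if_neg hz, mul_one]
    exact max_le (by linarith) (by linarith)

open Classical in
lemma le_sum_truncP {A Z : Finset V} {n r : ℕ} {s q : ℝ} {x : V} (hs : 0 ≤ s)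
    (hx : x ∈ A) (hq : expect G n (fun z => if z ∈ ball G x r then 0 else 1) x ≤ q)
    (hxZ : reach G n x ⊆ Z) :
    1 - (1 + entropy G n x) / (1 + s) - q ≤ ∑ z ∈ Z, truncP G A n r (Real.exp (-s)) z x := by
  have hq' : ∑ z ∈ Z, P G n x z * (if z ∈ ball G x r then 0 else 1) ≤ q := by
    refine le_trans (le_of_eq ?_) hq
    exact (tsum_eq_sum fun z hz => by rw [P_eq_zero G fun h => hz (hxZ h), zero_mul]).symm
  have h1 : 1 - (1 + entropy G n x) / (1 + s) =
      ∑ z ∈ Z, (P G n x z - (P G n x z + P G n x z * (-Real.log (P G n x z))) / (1 + s)) := by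
    rw [Finset.sum_sub_distrib, ← Finset.sum_div, Finset.sum_add_distrib,
      sum_P_of_reach_subset G hxZ, entropy_eq_sum G hxZ]
  refine (sub_le_sub_left hq' _).trans ?_
  rw [h1, ← Finset.sum_sub_distrib]
  refine Finset.sum_le_sum fun z _ => ?_
  have h0 := P_nonneg G n x z
  have h2 := sub_mul_le_max_sub_exp h0 (P_le_one G n x z) hs
  by_cases hz : z ∈ ball G x r
  · have h5 : truncP G A n r (Real.exp (-s)) z x = max (P G n x z - Real.exp (-s)) 0 :=
      if_pos ⟨hx, hz⟩
    rw [if_pos hz, mul_zero, sub_zero, h5]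
    exact h2
  · rw [if_neg hz, mul_one]
    have h3 : max (P G n x z - Real.exp (-s)) 0 ≤ P G n x z :=
      max_le (sub_le_self _ (Real.exp_pos _).le) h0
    linarith [truncP_nonneg G A n r (Real.exp (-s)) z x]

open Classical in
/-- A superlevel set of a truncated transition probability `P^n(·, z)` has boundary-to-volume
ratio at most `c`, if `c` is large compared with the total variation `τ` and the probability `q`
of a large displacement, and `A` is a good enough Følner set. -/
lemma exists_truncP_superlevel {A : Finset V} {n r : ℕ} {s q τ c μ : ℝ} (hs : 0 ≤ s) (hc : 0 ≤ c)
    (hτ : ∀ x y, G.Adj x y → tvDist G n x y ≤ τ) (hτq : 0 ≤ τ + q)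
    (hq : ∀ x, expect G n (fun z => if z ∈ ball G x r then 0 else 1) x ≤ q)
    (hμ : ∀ x, μ ≤ 1 - (1 + entropy G n x) / (1 + s) - q)
    (hA : (τ + q) * (∑ x ∈ A, (G.degree x : ℝ)) + (edgeBoundary G A).ncard <
      c * μ * ∑ x ∈ A, (G.degree x : ℝ)) :
    ∃ (z : V) (W : Finset V), W.Nonempty ∧ boundaryRatio G W ≤ c ∧
      ∀ x ∈ W, G.dist x z ≤ r ∧ Real.exp (-s) < P G n x z := by
  set F := truncP G A n r (Real.exp (-s)) with hF
  set Z := (A.biUnion (closedNbhd G)).biUnion (reach G n) with hZ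
  have hreach : ∀ x ∈ A, ∀ y ∈ closedNbhd G x, reach G n y ⊆ Z := fun x hx y hy =>
    Finset.subset_biUnion_of_mem (reach G n) (Finset.mem_biUnion.2 ⟨x, hx, hy⟩)
  have hgrad : ∑ z ∈ Z, ∑ x ∈ A, ∑ y ∈ G.neighborFinset x, max (F z x - F z y) 0 ≤
      (τ + q) * (∑ x ∈ A, (G.degree x : ℝ)) + (edgeBoundary G A).ncard := by
    rw [ncard_edgeBoundary, Finset.mul_sum, ← Finset.sum_add_distrib, Finset.sum_comm]
    refine Finset.sum_le_sum fun x hx => ?_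
    have h1 : (τ + q) * (G.degree x : ℝ) = ∑ y ∈ G.neighborFinset x, (τ + q) := by
      rw [Finset.sum_const, G.card_neighborFinset_eq_degree, nsmul_eq_mul, mul_comm]
    rw [h1, ← Finset.sum_add_distrib, Finset.sum_comm]
    refine Finset.sum_le_sum fun y hy => ?_
    have hxy : G.Adj x y := (G.mem_neighborFinset x y).1 hy
    by_cases hyA : y ∈ A
    · rw [if_pos hyA, add_zero]
      exact (sum_posPart_truncP_le G (Real.exp_pos _).le hyA (hq y)
        (hreach x hx x (self_mem_closedNbhd G x))
        (hreach x hx y ((mem_closedNbhd G).2 (Or.inr hxy)))).trans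
        (add_le_add_left (hτ x y hxy) q)
    -- An edge leaving `A` costs at most the whole mass `1` of the law from `x`; these edges are few
    -- by the choice of `A`.
    · rw [if_neg hyA]
      refine le_trans ?_ (le_add_of_nonneg_left hτq)
      refine le_trans (Finset.sum_le_sum fun z _ => ?_) (sum_P_le_one G n x Z)
      have h2 := truncP_le G A n r (Real.exp_pos (-s)).le z x
      have h3 := truncP_nonneg G A n r (Real.exp (-s)) z y
      exact max_le (by rw [hF]; linarith) (P_nonneg G n x z)
  have hmass : c * μ * ∑ x ∈ A, (G.degree x : ℝ) ≤
      ∑ z ∈ Z, c * ∑ x ∈ A, (G.degree x : ℝ) * F z x := by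
    rw [← Finset.mul_sum, Finset.sum_comm, mul_assoc, Finset.mul_sum (a := μ)]
    refine mul_le_mul_of_nonneg_left (Finset.sum_le_sum fun x hx => ?_) hc
    rw [← Finset.mul_sum, mul_comm]
    exact mul_le_mul_of_nonneg_left ((hμ x).trans (le_sum_truncP G hs hx (hq x)
      (hreach x hx x (self_mem_closedNbhd G x)))) (Nat.cast_nonneg _)
  -- Pigeonhole over `z`: variation is below `c` times mass for some endpoint.
  obtain ⟨z, -, hz⟩ := Finset.exists_lt_of_sum_lt ((hgrad.trans_lt hA).trans_le hmass)
  obtain ⟨t, ht, hne, hW⟩ := exists_superlevel_boundaryRatio_le G hc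
    (truncP_nonneg G A n r (Real.exp (-s)) z) (fun x hx => if_neg fun h => hx h.1) hz
  exact ⟨z, _, hne, hW, fun x hx => of_truncP_pos G (ht.trans_lt (Finset.mem_filter.1 hx).2)⟩

/-! ### Diameter and cardinality -/

lemma setDiam_le_two_mul {V : Type*} {G : SimpleGraph V} (hG : G.Connected) {W : Finset V} {z : V} {r : ℕ}
    (h : ∀ x ∈ W, G.dist x z ≤ r) : setDiam G W ≤ 2 * r := by
  refine Finset.sup_le fun x hx => Finset.sup_le fun y hy => ?_
  have h1 := hG.dist_triangle (u := x) (v := z) (w := y)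
  have h2 := h x hx
  have h3 := h y hy
  rw [G.dist_comm] at h3
  omega

lemma log_card_le {M n : ℕ} (hM : ∀ v, G.degree v ≤ M) {W : Finset V} {z : V}
    (h : W ⊆ reach G n z) : Real.log W.card ≤ 2 * M * n := by
  rcases W.eq_empty_or_nonempty with rfl | hne
  · simp only [Finset.card_empty, Nat.cast_zero, Real.log_zero]; positivity
  have h1 : (W.card : ℝ) ≤ ((M : ℝ) + 1) ^ n := by
    exact_mod_cast (Finset.card_le_card h).trans (card_reach_le G hM n z)
  have h2 := Real.log_le_log (by exact_mod_cast hne.card_pos) h1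
  rw [Real.log_pow] at h2
  have h3 : Real.log ((M : ℝ) + 1) ≤ M := by
    have := Real.log_le_sub_one_of_pos (show (0 : ℝ) < M + 1 by positivity)
    linarith
  have h4 : (n : ℝ) * Real.log ((M : ℝ) + 1) ≤ n * M :=
    mul_le_mul_of_nonneg_left h3 (Nat.cast_nonneg n)
  have h5 : (0 : ℝ) ≤ n * M := by positivity
  linarith

lemma mem_reach_of_P_pos {n : ℕ} {x z : V} (h : 0 < P G n x z) : z ∈ reach G n x := by
  by_contra hz
  exact h.ne' (P_eq_zero G hz)

lemma P_pos_symm (hdeg : ∀ v, 0 < G.degree v) {n : ℕ} {x z : V} (h : 0 < P G n x z) :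
    0 < P G n z x := by
  have h1 := degree_mul_P G n x z
  have h2 : (0 : ℝ) < G.degree x := by exact_mod_cast hdeg x
  have h3 : (0 : ℝ) < G.degree z := by exact_mod_cast hdeg z
  exact (pos_iff_pos_of_mul_pos (h1 ▸ mul_pos h2 h)).1 h3

/-- Reversibility gives `P^n(x, z) ≤ M P^n(z, x)`, and the law from `z` has total mass one. -/
lemma card_mul_exp_le {M n : ℕ} (hM : ∀ v, G.degree v ≤ M) (hdeg : ∀ v, 0 < G.degree v)
    {W : Finset V} {z : V} {s : ℝ} (h : ∀ x ∈ W, Real.exp (-s) < P G n x z) :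
    W.card * Real.exp (-s) ≤ M := by
  have hz : (G.degree z : ℝ) ≤ M := by exact_mod_cast hM z
  have h1 : ∀ x ∈ W, Real.exp (-s) ≤ M * P G n z x := by
    intro x hx
    have h2 : (1 : ℝ) ≤ G.degree x := by exact_mod_cast hdeg x
    have h3 := degree_mul_P G n x z
    have h4 := mul_le_mul_of_nonneg_right hz (P_nonneg G n z x)
    have h5 := mul_le_mul_of_nonneg_right h2 (P_nonneg G n x z)
    linarith [h x hx]
  have h2 := Finset.sum_le_sum h1
  rw [Finset.sum_const, nsmul_eq_mul, ← Finset.mul_sum] at h2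
  exact h2.trans (mul_le_of_le_one_right (Nat.cast_nonneg M) (sum_P_le_one G n z W))

/-! ### The three ranges of the total variation profile -/

/-- By connectedness all the time-`n` laws coincide. Laziness gives `P^n(y, y) > 0`, so every `y` is
reachable from `x₀` and the finite set `reach G n x₀` is all of `V`. -/
lemma exists_good_set_of_TV_eq_zero {M n : ℕ} (hG : G.Connected) (hM : ∀ v, G.degree v ≤ M)
    (h : TV G n = 0) :
    ∃ W : Finset V, W.Nonempty ∧ (setDiam G W : ℝ) ≤ 2 * n ∧ Real.log W.card ≤ 2 * M * n ∧
      boundaryRatio G W ≤ 0 := by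
  classical
  obtain ⟨x₀⟩ := hG.nonempty
  have hadj : ∀ x y, G.Adj x y → ∀ z, P G n x z = P G n y z := by
    intro x y hxy z
    by_cases hz : z ∈ reach G n x ∪ reach G n y
    · have h1 := tvDist_le_TV G n hxy
      rw [h, tvDist_eq_sum G Finset.subset_union_left Finset.subset_union_right] at h1
      have h2 := Finset.single_le_sum (f := fun z => |P G n x z - P G n y z|)
        (fun z _ => abs_nonneg _) hz
      have h3 : |P G n x z - P G n y z| ≤ 0 := by linarith
      exact sub_eq_zero.1 (abs_nonpos_iff.1 h3)
    · rw [Finset.mem_union, not_or] at hz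
      rw [P_eq_zero G hz.1, P_eq_zero G hz.2]
  have hall : ∀ y z, P G n x₀ z = P G n y z := by
    intro y z
    obtain ⟨w⟩ := hG.preconnected x₀ y
    induction w with
    | nil => rfl
    | cons hxy _ ih => rw [hadj _ _ hxy z, ih]
  have hmem : ∀ y, y ∈ reach G n x₀ := fun y =>
    mem_reach_of_P_pos G (by rw [hall y y]; exact P_self_pos G n y)
  refine ⟨reach G n x₀, ⟨x₀, hmem x₀⟩, ?_, log_card_le G hM subset_rfl, ?_⟩
  · exact_mod_cast setDiam_le_two_mul hG (z := x₀) fun x hx => by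
      rw [G.dist_comm]; exact dist_le_of_mem_reach G hG hx
  · have : edgeBoundary G (reach G n x₀) = ∅ :=
      Set.eq_empty_of_forall_notMem fun e ⟨_, _, y, hy, _⟩ => hy (hmem y)
    simp [boundaryRatio, this]

lemma boundaryRatio_singleton_le_one (x : V) : boundaryRatio G {x} ≤ 1 := by
  classical
  refine div_le_one_of_le₀ ?_ (Finset.sum_nonneg fun _ _ => Nat.cast_nonneg _)
  rw [ncard_edgeBoundary]
  refine Finset.sum_le_sum fun x _ => ?_
  rw [← G.card_neighborFinset_eq_degree x, Finset.cast_card]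
  exact Finset.sum_le_sum fun y _ => by split_ifs <;> norm_num

lemma exists_boundaryRatio_lt (hG : IsAmenable G) [Nonempty V] {ε : ℝ} (hε : 0 < ε) :
    ∃ A : Finset V, A.Nonempty ∧ boundaryRatio G A < ε := by
  obtain ⟨x⟩ := ‹Nonempty V›
  have : Nonempty {W : Finset V // W.Nonempty} := ⟨⟨{x}, Finset.singleton_nonempty x⟩⟩
  obtain ⟨⟨A, hA⟩, h⟩ := exists_lt_of_ciInf_lt (hG.trans_lt hε)
  exact ⟨A, hA, h⟩

lemma exists_good_set_of_TV_lt {M n : ℕ} (hG : G.Connected) (hM : ∀ v, G.degree v ≤ M)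
    (hGa : IsAmenable G) (hn : 1 ≤ n) (h0 : TV G n ≠ 0) (h4 : TV G n < 1 / 4) :
    ∃ W : Finset V, W.Nonempty ∧ (setDiam G W : ℝ) ≤ 2 * n ∧
      (setDiam G W : ℝ) ≤ 54 * Dstar G n * Real.log (1 / TV G n) ∧
      Real.log W.card ≤ 2 * M * n ∧
      Real.log W.card ≤ (2 * M + 24) * Hstar G n * Real.log (1 / TV G n) ∧
      boundaryRatio G W ≤ 4 * TV G n := by
  classical
  set τ := TV G n with hτ
  have hτ0 : 0 < τ := lt_of_le_of_ne (TV_nonneg G n) (Ne.symm h0)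
  obtain ⟨x₀, y₀, hxy⟩ : ∃ x y, G.Adj x y := by
    by_contra! hcon
    have : IsEmpty {p : V × V // G.Adj p.1 p.2} := ⟨fun p => hcon _ _ p.2⟩
    exact h0 (Real.iSup_of_isEmpty _)
  have : Nontrivial V := ⟨x₀, y₀, hxy.ne⟩
  have hdeg : ∀ v, 0 < G.degree v := fun v => hG.preconnected.degree_pos_of_nontrivial v
  set D := Dstar G n with hD
  set H := Hstar G n with hH
  have hD2 : 1 / 2 ≤ D :=
    (half_le_expDisplacement_one G hG (hdeg x₀)).trans (expDisplacement_le_Dstar G hG hn x₀)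
  have hH2 : 1 / 2 ≤ H :=
    (half_le_entropy_one G (hdeg x₀)).trans (entropy_le_Hstar G hM hn x₀)
  set L := Real.log (1 / τ) with hL
  have hτL : Real.exp (-L) = τ := by rw [hL, one_div, Real.log_inv, neg_neg, Real.exp_log hτ0]
  -- Here `τ < 1/4 < 1/e`.
  have hL1 : 1 ≤ L := by
    rw [hL, Real.le_log_iff_exp_le (by positivity), le_div_iff₀ hτ0]
    nlinarith [Real.exp_one_lt_d9]
  -- the truncation radius
  set R := ⌈5 * D⌉₊ with hR
  -- The first `⌈L⌉₊` exits give a factor `τ`, the additional one the `1/4` in `hq`.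
  set k := ⌈L⌉₊ + 1 with hk
  have hR1 : 5 * D ≤ R := Nat.le_ceil _
  have hR2 : (R : ℝ) < 5 * D + 1 := Nat.ceil_lt_add_one (by linarith)
  have hk1 : L + 1 ≤ k := by rw [hk]; push_cast; linarith [Nat.le_ceil L]
  have hk2 : (k : ℝ) < L + 2 := by
    rw [hk]; push_cast; linarith [Nat.ceil_lt_add_one (show 0 ≤ L by linarith)]
  have hq : ∀ x, expect G n (fun z => if z ∈ ball G x (k * (R + 1)) then 0 else 1) x ≤ τ / 4 := by
    intro x
    refine (expect_indicator_ball_compl_le G hG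
      (fun m hm x => expDisplacement_le_Dstar G hG hm x) hR1 k x).trans ?_
    have h1 : ((1 : ℝ) / 4) ^ ⌈L⌉₊ ≤ τ := by
      have h2 : (1 : ℝ) / 4 ≤ Real.exp (-1) := by
        rw [Real.exp_neg, ← one_div]
        exact one_div_le_one_div_of_le (Real.exp_pos 1) (by linarith [Real.exp_one_lt_d9])
      refine (pow_le_pow_left₀ (by norm_num) h2 _).trans ?_
      rw [← Real.exp_nat_mul, ← hτL]
      exact Real.exp_le_exp.2 (by linarith [Nat.le_ceil L])
    rw [hk, pow_succ]
    linarith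
  -- the Følner set
  obtain ⟨A, hAne, hA⟩ := exists_boundaryRatio_lt G hGa (ε := τ / 2) (by linarith)
  have hvol : 0 < ∑ x ∈ A, (G.degree x : ℝ) :=
    Finset.sum_pos (fun x _ => by exact_mod_cast hdeg x) hAne
  rw [boundaryRatio, div_lt_iff₀ hvol] at hA
  -- Budget per unit of volume: variation below `τ + τ/4 + τ/2 < 2τ = c μ`. The choice of `s` makes
  -- the threshold loss at most `1/8`, and the cutoff loses at most `1/16`, leaving mass at least `μ
  -- = 1/2`.
  obtain ⟨z, W, hne, hW, hWz⟩ := exists_truncP_superlevel G (A := A) (n := n)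
    (r := k * (R + 1)) (s := 8 * (1 + H)) (q := τ / 4) (τ := τ) (c := 4 * τ) (μ := 1 / 2)
    (by linarith) (by linarith) (fun x y hxy => tvDist_le_TV G n hxy) (by linarith) hq
    (fun x => by
      have h1 : entropy G n x ≤ H := entropy_le_Hstar G hM le_rfl x
      have h2 : (1 + entropy G n x) / (1 + 8 * (1 + H)) ≤ 1 / 8 := by
        rw [div_le_iff₀ (by linarith)]
        linarith
      linarith)
    (by nlinarith)
  have hpos : ∀ x ∈ W, 0 < P G n x z := fun x hx => (Real.exp_pos _).trans (hWz x hx).2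
  refine ⟨W, hne, ?_, ?_, ?_, ?_, hW⟩
  · exact_mod_cast setDiam_le_two_mul hG (z := z) fun x hx =>
      dist_le_of_mem_reach G hG (mem_reach_of_P_pos G (hpos x hx))
  · have h1 : (setDiam G W : ℝ) ≤ 2 * (k * (R + 1)) := by
      exact_mod_cast setDiam_le_two_mul hG (z := z) fun x hx => (hWz x hx).1
    -- Uses `k < L + 2 ≤ 3L` and `R + 1 < 5D + 2 ≤ 9D`, whence `54 = 2 · 3 · 9`.
    have h2 : (k : ℝ) * (R + 1) ≤ (3 * L) * (9 * D) :=
      mul_le_mul (by linarith) (by linarith) (by positivity) (by linarith)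
    linarith
  · exact log_card_le G hM (z := z) fun x hx =>
      mem_reach_of_P_pos G (P_pos_symm G hdeg (hpos x hx))
  · have h1 := card_mul_exp_le G hM hdeg fun x hx => (hWz x hx).2
    have hcard : (0 : ℝ) < W.card := by exact_mod_cast hne.card_pos
    have h2 := Real.log_le_log (mul_pos hcard (Real.exp_pos _)) h1
    rw [Real.log_mul hcard.ne' (Real.exp_pos _).ne', Real.log_exp] at h2
    have hM0 : (0 : ℝ) < M := by exact_mod_cast (hdeg x₀).trans_le (hM x₀)
    have h3 := Real.log_le_sub_one_of_pos hM0
    -- From `log |W| ≤ 8 (1 + H) + M - 1` and `1 ≤ 2H`. The factor `L ≥ 1` is inserted only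
    -- afterwards.
    have h5 : Real.log W.card ≤ (2 * M + 24) * H := by nlinarith
    refine h5.trans (le_mul_of_one_le_right ?_ hL1)
    exact mul_nonneg (by linarith) (by linarith)

end LazyWalk

/-- The bounds by `min {a, b}` are stated as the bound by `a` together with the bound by `b`.
When `TV_n = 0`, `log (1 / TV_n)` is `+∞` and the second bound is void, whence the hypothesis
`TV_n ≠ 0` for it. -/
theorem theorem1 (M : ℕ) :
    ∃ C : ℝ, 0 < C ∧
      ∀ (V : Type*) (G : SimpleGraph V) [G.LocallyFinite],
        G.Connected → (∀ v, G.degree v ≤ M) → LazyWalk.IsAmenable G →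
        ∀ n : ℕ, 1 ≤ n →
          ∃ W : Finset V, W.Nonempty ∧
            (LazyWalk.setDiam G W : ℝ) ≤ 2 * n ∧
            (LazyWalk.TV G n ≠ 0 →
              (LazyWalk.setDiam G W : ℝ) ≤
                C * LazyWalk.Dstar G n * Real.log (1 / LazyWalk.TV G n)) ∧
            Real.log (W.card : ℝ) ≤ 2 * M * n ∧
            (LazyWalk.TV G n ≠ 0 →
              Real.log (W.card : ℝ) ≤
                C * (LazyWalk.Hstar G n + Real.log n) * Real.log (1 / LazyWalk.TV G n)) ∧
            LazyWalk.boundaryRatio G W ≤ 4 * LazyWalk.TV G n := by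
  -- This dominates both `54` (diameter) and `2M + 24` (cardinality).
  refine ⟨2 * M + 54, by positivity, fun V G _ hG hM hGa n hn => ?_⟩
  have : Nonempty V := hG.nonempty
  obtain ⟨x₀⟩ := ‹Nonempty V›
  have hn' : (1 : ℝ) ≤ n := by exact_mod_cast hn
  have hlogn : 0 ≤ Real.log n := Real.log_nonneg hn'
  have hM0 : (0 : ℝ) ≤ M := Nat.cast_nonneg M
  have hC : (0 : ℝ) ≤ 2 * M + 54 := by positivity
  have hD0 : 0 ≤ LazyWalk.Dstar G n := by
    have h := LazyWalk.expDisplacement_le_Dstar G hG (Nat.zero_le n) x₀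
    rwa [show LazyWalk.expDisplacement G 0 x₀ = 0 from
      (LazyWalk.expect_zero G _ x₀).trans (by simp)] at h
  have hH0 : 0 ≤ LazyWalk.Hstar G n := by
    have h := LazyWalk.entropy_le_Hstar G hM (Nat.zero_le n) x₀
    rwa [show LazyWalk.entropy G 0 x₀ = 0 from
      (LazyWalk.expect_zero G _ x₀).trans (by simp [LazyWalk.P])] at h
  have hL0 : LazyWalk.TV G n ≠ 0 → 0 ≤ Real.log (1 / LazyWalk.TV G n) := fun h0 =>
    Real.log_nonneg ((one_le_div (lt_of_le_of_ne (LazyWalk.TV_nonneg G n) (Ne.symm h0))).2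
      (LazyWalk.TV_le_one G n))
  by_cases h0 : LazyWalk.TV G n = 0
  · obtain ⟨W, hne, h1, h2, h3⟩ := LazyWalk.exists_good_set_of_TV_eq_zero G hG hM h0
    exact ⟨W, hne, h1, fun h => absurd h0 h, h2, fun h => absurd h0 h, by rw [h0]; linarith⟩
  rcases lt_or_ge (LazyWalk.TV G n) (1 / 4) with h4 | h4
  · obtain ⟨W, hne, h1, h2, h3, h5, h6⟩ :=
      LazyWalk.exists_good_set_of_TV_lt G hG hM hGa hn h0 h4
    refine ⟨W, hne, h1, fun _ => h2.trans ?_, h3, fun _ => h5.trans ?_, h6⟩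
    · exact mul_le_mul_of_nonneg_right (mul_le_mul_of_nonneg_right (by linarith) hD0) (hL0 h0)
    · exact mul_le_mul_of_nonneg_right
        (mul_le_mul (by linarith) (by linarith) hH0 hC) (hL0 h0)
  -- For `TV_n ≥ 1/4` the ratio bound is at least `1`, which a singleton meets.
  · have hdiam : LazyWalk.setDiam G {x₀} = 0 := by simp [LazyWalk.setDiam]
    refine ⟨{x₀}, Finset.singleton_nonempty x₀, ?_, fun _ => ?_, ?_, fun _ => ?_, ?_⟩
    · rw [hdiam]; push_cast; positivity
    · rw [hdiam, Nat.cast_zero]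
      exact mul_nonneg (mul_nonneg hC hD0) (hL0 h0)
    · simp only [Finset.card_singleton, Nat.cast_one, Real.log_one]; positivity
    · simp only [Finset.card_singleton, Nat.cast_one, Real.log_one]
      exact mul_nonneg (mul_nonneg hC (add_nonneg hH0 hlogn)) (hL0 h0)
    · linarith [LazyWalk.boundaryRatio_singleton_le_one G x₀]
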